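/- **Setting.** A (kernel) Timetide program consists of finitely many threads $t_1 <> \dots <> t_n$ and finitely many point-to-point channels; channel $c$ leads from a thread $\mathrm{src}(c)$ to a thread $\mathrm{dst}(c)$ and has a logical delay $\delta_c\in\mathbb N$ and $\delta_c$ initial tokens (empty frames, unless initial values are specified). Threads are built from `nothing`, assignment, variable declaration, expression statements, `send c(e)`, `sync d`, `if`, `loop`, sequence, `checkabort(e,L)` and `abort t when c:L`; expressions may read a channel and test `fresh(c)`. Assume that (i) every iteration of every loop passes a `sync`, (ii) every `checkabort` refers to an enclosing `abort`, and (iii) there is no cycle of channels of delay $0$. Each thread is translated to an Esterel module (the same for both targets), which at the beginning of each instant samples its non-empty inputs and before each `pause` emits the contents of its mailboxes; `sync d` becomes $d$ such pauses, and `abort`/`checkabort` become `trap`/`exit`. *Distributed target.* Each module is a separate Esterel program with its own logical clock, starting at $0$. Each channel $c$ is a FIFO pre-populated with its $\delta_c$ initial tokens. A thread may make a tick only if all of its inbound FIFOs are non-empty; it then pops a token from each of them, performs one reaction of its module, and pushes one (possibly empty) token to each of its outbound FIFOs. In each step of an execution an arbitrary set of such threads makes a tick. An execution is fair if no thread whose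 inbound FIFOs are non-empty waits forever. *Centralised target.* A single Esterel program: the parallel composition of all modules and, for each channel $c$ with $\delta_c=n$, of signals $c_0,\dots,c_n$ and registers `loop emit c_{k+1}(pre(c_k)); pause end` for $0\le k<n$, each preceded by the emission of the corresponding initial value, if there is one (in the first instant $c_{k+1}$ carries the initial token with index $n-1-k$, where index $0$ is the head of the FIFO). The sender writes $c_0$, the receiver reads $c_n$. An execution is a sequence of reactions in which the signal statuses are coherent (a signal is present with value $v$ iff it is emitted with value $v$). **Theorem.** The execution of the distributed target is equivalent to that of the centralised target. Precisely: the centralised target has exactly one execution, and 1. in every execution of the distributed target, whenever the clock of a thread is $k$, its residual statement and its datastore are those of this thread in the centralised execution before instant $k$; and when the thread makes a tick at clock $k$, the tokens that it pops from its inbound channels and those that it pushes to its outbound channels are the statuses in instant $k$ of the signals $c_{\delta_c}$ and $c_0$, respectively, of these channels; 2. in every fair execution of the distributed target each thread makes, for every $k\in\mathbb N$, exactly one tick at clock $k$, so that every reaction of the centralised execution takes place; 3. fair executions of the distributed target exist, and every finite part of an execution can be extended to a fair one. -/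

import Mathlib

namespace Timetide

universe u

/-- Run-time values. `H` collects the host data types (floats, records, ...); `bot` is the undefined
value of a variable that has been declared but not assigned. -/
inductive Value (H : Type u) : Type u
  | bot
  | bool (b : Bool)
  | int (z : ℤ)
  | host (h : H)

def Value.isTrue {H : Type u} : Value H → Bool
  | .bool b => b
  | _ => false

/-- What a channel or a signal carries in one logical tick: `none` is the empty frame (for a signal:
absent), `some v` is a frame holding `v` (for a signal: present with value `v`). -/
abbrev Token (H : Type u) : Type u := Option (Value H)

/-! ### Esterel

Signals are named by `S`, variables by `X`, traps by natural numbers. -/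

namespace Esterel

/-- Data expressions; `app f args` is the call of a (pure) operator or host function. -/
inductive Expr (X : Type) (H : Type u) : Type u
  | const (v : Value H)
  | var (x : X)
  | app {a : ℕ} (f : (Fin a → Value H) → Value H) (args : Fin a → Expr X H)

def Expr.eval {X : Type} {H : Type u} (μ : X → Value H) : Expr X H → Value H
  | .const v => v
  | .var x => μ x
  | .app f args => f fun i => (args i).eval μ

/-- Sequential Esterel statements.
* `emit s e` is `emit s(e)`;
* `emitPre s r` is `emit s(pre(r))`: if `r` was present in the previous instant then `s` is emitted
  now with the value that `r` had;
* `present s x p q` is `present s then x := ?s; p else q end`. -/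
inductive Stmt (S X : Type) (H : Type u) : Type u
  | nothing
  | pause
  | assign (x : X) (e : Expr X H)
  | emit (s : S) (e : Expr X H)
  | emitPre (s r : S)
  | present (s : S) (x : X) (p q : Stmt S X H)
  | ite (e : Expr X H) (p q : Stmt S X H)
  | seq (p q : Stmt S X H)
  | loop (p : Stmt S X H)
  | trap (L : ℕ) (p : Stmt S X H)
  | exit (L : ℕ)

def Stmt.seqs {S X : Type} {H : Type u} : List (Stmt S X H) → Stmt S X H
  | [] => .nothing
  | p :: ps => .seq p (seqs ps)

/-- The status of all signals in the current instant and in the previous one. -/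
structure Env (S : Type) (H : Type u) : Type u where
  cur : S → Token H
  pre : S → Token H

/-- How a statement completes an instant: it terminates, or it pauses with a residual statement, or
it exits a trap. The memory after the instant and the emitted signals are recorded. -/
inductive Outcome (S X : Type) (H : Type u) : Type u
  | done (μ : X → Value H) (out : List (S × Value H))
  | pause (p : Stmt S X H) (μ : X → Value H) (out : List (S × Value H))
  | exit (L : ℕ) (μ : X → Value H) (out : List (S × Value H))

def Outcome.emitFirst {S X : Type} {H : Type u} (o : List (S × Value H)) :
    Outcome S X H → Outcome S X H
  | .done μ o' => .done μ (o ++ o')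
  | .pause p μ o' => .pause p μ (o ++ o')
  | .exit L μ o' => .exit L μ (o ++ o')

/-- One instant of a sequential statement, given the statuses of the signals (behavioural
semantics). The result `none` means that there is no reaction: as usual, the rule for `loop` requires
that the body does not terminate in the instant in which it is started. -/
def Stmt.react {S X : Type} {H : Type u} [DecidableEq X] (E : Env S H) :
    Stmt S X H → (X → Value H) → Option (Outcome S X H)
  | .nothing, μ => some (.done μ [])
  | .pause, μ => some (.pause .nothing μ [])
  | .assign x e, μ => some (.done (Function.update μ x (e.eval μ)) [])
  | .emit s e, μ => some (.done μ [(s, e.eval μ)])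
  | .emitPre s r, μ =>
      match E.pre r with
      | some v => some (.done μ [(s, v)])
      | none => some (.done μ [])
  | .present s x p q, μ =>
      match E.cur s with
      | some v => p.react E (Function.update μ x v)
      | none => q.react E μ
  | .ite e p q, μ => if (e.eval μ).isTrue then p.react E μ else q.react E μ
  | .seq p q, μ =>
      match p.react E μ with
      | none => none
      | some (.done μ' o) => (q.react E μ').map (Outcome.emitFirst o)
      | some (.pause p' μ' o) => some (.pause (.seq p' q) μ' o)
      | some (.exit L μ' o) => some (.exit L μ' o)
  | .loop p, μ =>
      match p.react E μ with
      | none => none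
      | some (.done _ _) => none
      | some (.pause p' μ' o) => some (.pause (.seq p' (.loop p)) μ' o)
      | some (.exit L μ' o) => some (.exit L μ' o)
  | .trap L p, μ =>
      match p.react E μ with
      | none => none
      | some (.done μ' o) => some (.done μ' o)
      | some (.pause p' μ' o) => some (.pause (.trap L p') μ' o)
      | some (.exit L' μ' o) => if L' = L then some (.done μ' o) else some (.exit L' μ' o)
  | .exit L, μ => some (.exit L μ [])

/-- The state of a module instance: the residual statement and the values of its own variables. -/
structure ModState (S X : Type) (H : Type u) : Type u where
  code : Stmt S X H
  mem : X → Value H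

/-- The tick of a module instance: it yields the next state and the emitted signals. A module that
has terminated stays terminated and emits nothing. -/
def ModState.tick {S X : Type} {H : Type u} [DecidableEq X] (E : Env S H) (m : ModState S X H) :
    Option (ModState S X H × List (S × Value H)) :=
  match m.code.react E m.mem with
  | some (.done μ o) => some (⟨.nothing, μ⟩, o)
  | some (.pause p μ o) => some (⟨p, μ⟩, o)
  | some (.exit _ _ _) => none
  | none => none

/-- The Esterel program
`signal S in run M₁[S/ports] || run M₂[S/ports] || ... end`
with signals `S`, and with a module instance for every `i : I`, whose port `p : Q` is bound to the
signal `bind i p`. The instances have variables of their own, and `pre s` is the status of the signal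
`s` in the previous instant. -/
structure Program (S I Q X : Type) (H : Type u) : Type u where
  bind : I → Q → S
  inst : I → ModState Q X H
  pre : S → Token H

/-- A reaction of a program in which the signals have the statuses `E`. All instances react in
parallel to the same statuses. The statuses of the signals in `input` are chosen by the environment;
for every other signal the statuses are coherent with the reaction, that is, a signal is present with
value `v` exactly if some instance emits it with value `v`. -/
def Program.Reacts {S I Q X : Type} {H : Type u} [DecidableEq X] (input : S → Prop)
    (A : Program S I Q X H) (E : S → Token H) (B : Program S I Q X H) : Prop :=
  ∃ out : I → List (Q × Value H),
    (∀ i, (A.inst i).tick ⟨fun p => E (A.bind i p), fun p => A.pre (A.bind i p)⟩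
      = some (B.inst i, out i)) ∧
    (∀ s, ¬ input s → ∀ v, E s = some v ↔ ∃ i p, A.bind i p = s ∧ (p, v) ∈ out i) ∧
    B.bind = A.bind ∧
    B.pre = E

end Esterel

/-! ### The kernel of Timetide

Channels are named by `Fin m`, variables and abort labels by natural numbers. -/

/-- Expressions. `read c` is the most recent value sampled from channel `c`, `fresh c` tells whether
that value has not been read yet, and `app f args` is an operator or a host function. -/
inductive Expr (m : ℕ) (H : Type u) : Type u
  | const (v : Value H)
  | var (x : ℕ)
  | read (c : Fin m)
  | fresh (c : Fin m)
  | app {a : ℕ} (f : (Fin a → Value H) → Value H) (args : Fin a → Expr m H)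

/-- The channels that are read by an expression. -/
def Expr.reads {m : ℕ} {H : Type u} : Expr m H → List (Fin m)
  | .const _ => []
  | .var _ => []
  | .read c => [c]
  | .fresh _ => []
  | .app _ args => (List.ofFn fun i => (args i).reads).flatten

/-- Kernel statements of a thread. `abort L t` is `abort t when c:L`; its condition `c` is tested by
the statements `checkabort c L` in the body `t`. -/
inductive Stmt (m : ℕ) (H : Type u) : Type u
  | nothing
  | assign (x : ℕ) (e : Expr m H)
  | varDecl (x : ℕ)
  | expr (e : Expr m H)
  | send (c : Fin m) (e : Expr m H)
  | sync (d : ℕ)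
  | ite (e : Expr m H) (t u : Stmt m H)
  | loop (t : Stmt m H)
  | seq (t u : Stmt m H)
  | checkabort (e : Expr m H) (L : ℕ)
  | abort (L : ℕ) (t : Stmt m H)

/-- First component: started now, `t` may terminate without having passed a `sync`. Second component:
the labels `L` such that `t`, started now, may reach a `checkabort _ L` (outside an `abort L` in `t`)
before it has passed a `sync`. -/
def Stmt.mayEndExit {m : ℕ} {H : Type u} : Stmt m H → Prop × Set ℕ
  | .sync d => (d = 0, ∅)
  | .ite _ t u => (t.mayEndExit.1 ∨ u.mayEndExit.1, t.mayEndExit.2 ∪ u.mayEndExit.2)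
  | .loop t => (False, t.mayEndExit.2)
  | .seq t u => (t.mayEndExit.1 ∧ u.mayEndExit.1,
      t.mayEndExit.2 ∪ {L | t.mayEndExit.1 ∧ L ∈ u.mayEndExit.2})
  | .checkabort _ L => (True, {L})
  | .abort L t => (t.mayEndExit.1 ∨ L ∈ t.mayEndExit.2, t.mayEndExit.2 \ {L})
  | _ => (True, ∅)

def Stmt.MayEnd {m : ℕ} {H : Type u} (t : Stmt m H) : Prop := t.mayEndExit.1

/-- Every iteration of every loop passes a `sync`. -/
def Stmt.LoopsGuarded {m : ℕ} {H : Type u} : Stmt m H → Prop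
  | .ite _ t u => t.LoopsGuarded ∧ u.LoopsGuarded
  | .loop t => ¬ t.MayEnd ∧ t.LoopsGuarded
  | .seq t u => t.LoopsGuarded ∧ u.LoopsGuarded
  | .abort _ t => t.LoopsGuarded
  | _ => True

/-- Every `checkabort _ L` lies in an `abort L` or has its label in `scope`. -/
def Stmt.LabelsBound {m : ℕ} {H : Type u} (scope : Set ℕ) : Stmt m H → Prop
  | .ite _ t u => t.LabelsBound scope ∧ u.LabelsBound scope
  | .loop t => t.LabelsBound scope
  | .seq t u => t.LabelsBound scope ∧ u.LabelsBound scope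
  | .checkabort _ L => L ∈ scope
  | .abort L t => t.LabelsBound (insert L scope)
  | _ => True

/-- A Timetide program: the parallel composition `t₁ <> t₂ <> ...` of threads, which communicate
through point-to-point channels. Channel `c` leads from thread `src c` to thread `dst c` and has the
logical delay `delay c`; `init c` lists the tokens that are received in the first `delay c` ticks
(the empty frame `none`, unless an initial value is specified). The tree structure of nested `<>` has
no semantic meaning, so the threads form a flat family. Only `src c` can emit on `c` and only `dst c`
receives from `c`; elsewhere `send c` has no effect and `read c` is undefined. -/
structure Program (H : Type u) : Type u where
  threads : ℕ
  chans : ℕ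
  body : Fin threads → Stmt chans H
  src : Fin chans → Fin threads
  dst : Fin chans → Fin threads
  delay : Fin chans → ℕ
  init : (c : Fin chans) → Fin (delay c) → Token H

/-- The static conditions on a program. The last one excludes causality cycles: no thread depends on
itself through a cycle of channels without delay. -/
structure Program.WellFormed {H : Type u} (P : Program H) : Prop where
  loops : ∀ i, (P.body i).LoopsGuarded
  labels : ∀ i, (P.body i).LabelsBound ∅
  causal : ∀ i, ¬ Relation.TransGen
    (fun i j => ∃ c, P.src c = i ∧ P.dst c = j ∧ P.delay c = 0) i i

/-! ### Translation of a thread to an Esterel module -/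

/-- The interface signals of the modules. -/
inductive Port (m : ℕ) : Type
  | inp (c : Fin m)
  | out (c : Fin m)

/-- The variables of a module: those of the thread, the last non-empty value received on a channel
with its freshness flag, and the mailbox of a channel with a flag that tells whether it is full. -/
inductive Var (m : ℕ) : Type
  | user (x : ℕ)
  | val (c : Fin m)
  | fresh (c : Fin m)
  | box (c : Fin m)
  | full (c : Fin m)
  deriving DecidableEq

abbrev Code (m : ℕ) (H : Type u) : Type u := Esterel.Stmt (Port m) (Var m) H

abbrev Module (m : ℕ) (H : Type u) : Type u := Esterel.ModState (Port m) (Var m) H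

def Expr.toEsterel {m : ℕ} {H : Type u} : Expr m H → Esterel.Expr (Var m) H
  | .const v => .const v
  | .var x => .var (.user x)
  | .read c => .var (.val c)
  | .fresh c => .var (.fresh c)
  | .app f args => .app f fun i => (args i).toEsterel

/-- After an expression has been evaluated, the values read in it are no longer fresh. -/
def Expr.unfresh {m : ℕ} {H : Type u} (e : Expr m H) : Code m H :=
  .seqs (e.reads.map fun c => .assign (.fresh c) (.const (.bool false)))

/-- Receive the incoming tokens; an empty frame leaves the sampled value as it is. -/
def receive {m : ℕ} {H : Type u} (ins : List (Fin m)) : Code m H :=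
  .seqs (ins.map fun c =>
    .present (.inp c) (.val c) (.assign (.fresh c) (.const (.bool true))) .nothing)

/-- Emit the contents of the full mailboxes, and empty them. -/
def flush {m : ℕ} {H : Type u} (outs : List (Fin m)) : Code m H :=
  .seqs (outs.map fun c =>
    .ite (.var (.full c))
      (.seq (.emit (.out c) (.var (.box c))) (.assign (.full c) (.const (.bool false))))
      .nothing)

def Stmt.toEsterel {m : ℕ} {H : Type u} (ins outs : List (Fin m)) : Stmt m H → Code m H
  | .nothing => .nothing
  | .assign x e => .seq (.assign (.user x) e.toEsterel) e.unfresh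
  | .varDecl x => .assign (.user x) (.const .bot)
  | .expr e => e.unfresh
  | .send c e => .seqs [.assign (.box c) e.toEsterel,
      .assign (.full c) (.const (.bool true)), e.unfresh]
  | .sync d => .seqs (List.replicate d (.seqs [flush outs, .pause, receive ins]))
  | .ite e t u => .ite e.toEsterel
      (.seq e.unfresh (t.toEsterel ins outs)) (.seq e.unfresh (u.toEsterel ins outs))
  | .loop t => .loop (t.toEsterel ins outs)
  | .seq t u => .seq (t.toEsterel ins outs) (u.toEsterel ins outs)
  | .checkabort e L => .ite e.toEsterel (.seq e.unfresh (.exit L)) e.unfresh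
  | .abort L t => .trap L (t.toEsterel ins outs)

/-- The variables at the start: undefined, nothing fresh, all mailboxes empty. -/
def initMem {m : ℕ} {H : Type u} : Var m → Value H
  | .fresh _ => .bool false
  | .full _ => .bool false
  | _ => .bot

namespace Program

variable {H : Type u} (P : Program H)

/-- The channels that arrive at a thread, and those that leave it. -/
def ins (i : Fin P.threads) : List (Fin P.chans) :=
  (List.finRange P.chans).filter fun c => P.dst c = i

def outs (i : Fin P.threads) : List (Fin P.chans) :=
  (List.finRange P.chans).filter fun c => P.src c = i

/-- The Esterel module that is generated for a thread; it is the same for both targets. -/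
def threadModule (i : Fin P.threads) : Module P.chans H where
  code := .seq (receive (P.ins i)) ((P.body i).toEsterel (P.ins i) (P.outs i))
  mem := initMem

/-! ### The distributed target -/

/-- The Esterel program generated for a single thread, compiled on its own. -/
abbrev ThreadProgram : Type u :=
  Esterel.Program (Port P.chans) Unit (Port P.chans) (Var P.chans) H

/-- The signals that the wrapper of thread `i` feeds from the FIFOs. -/
def IsInput (i : Fin P.threads) : Port P.chans → Prop
  | .inp c => P.dst c = i
  | .out _ => False

/-- A configuration of the distributed system: the Esterel program of each thread, the contents of
the FIFO of each channel (head first), and the logical clock of each thread. -/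
structure Config : Type u where
  prog : Fin P.threads → P.ThreadProgram
  fifo : Fin P.chans → List (Token H)
  clock : Fin P.threads → ℕ

/-- In the beginning the FIFO of each channel is pre-populated with `delay c` tokens. -/
def distributed : P.Config where
  prog i := { bind := fun _ p => p, inst := fun _ => P.threadModule i, pre := fun _ => none }
  fifo c := List.ofFn (P.init c)
  clock _ := 0

/-- The (blocking) reads of thread `i` can be served. -/
def Config.Ready {P : Program H} (s : P.Config) (i : Fin P.threads) : Prop :=
  ∀ c, P.dst c = i → s.fifo c ≠ []

/-- A step in which the threads in `F` perform one cycle of their wrapper: pop a token from each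
inbound FIFO, perform a reaction of the module (with signal statuses `E i`), and push the status of
each output signal to the FIFO of its channel. All other threads are idle. -/
structure Config.Step {P : Program H} (F : Finset (Fin P.threads))
    (E : Fin P.threads → Port P.chans → Token H) (s s' : P.Config) : Prop where
  ready : ∀ i ∈ F, s.Ready i
  pop : ∀ i ∈ F, ∀ c, P.dst c = i → (s.fifo c).head? = some (E i (.inp c))
  react : ∀ i ∈ F, (s.prog i).Reacts (P.IsInput i) (E i) (s'.prog i)
  tick : ∀ i ∈ F, s'.clock i = s.clock i + 1
  idle : ∀ i, i ∉ F → s'.prog i = s.prog i ∧ s'.clock i = s.clock i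
  fifo : ∀ c, s'.fifo c =
    (if P.dst c ∈ F then (s.fifo c).tail else s.fifo c) ++
      (if P.src c ∈ F then [E (P.src c) (.out c)] else [])

/-- An execution of the distributed target. In step `t` an arbitrary set `fires t` of threads makes
progress, so that every interleaving is covered; steps in which no thread makes progress are allowed,
so that finite executions are covered too. -/
@[ext]
structure DistExec : Type u where
  state : ℕ → P.Config
  fires : ℕ → Finset (Fin P.threads)
  sig : ℕ → Fin P.threads → Port P.chans → Token H
  start : state 0 = P.distributed
  step : ∀ t, Config.Step (fires t) (sig t) (state t) (state (t + 1))

/-- No thread whose inbound tokens are available waits forever. -/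
def DistExec.Fair {P : Program H} (D : P.DistExec) : Prop :=
  ∀ t i, (D.state t).Ready i → ∃ t' ≥ t, i ∈ D.fires t'

/-! ### The centralised target -/

/-- The signals `c_0, ..., c_n` of each channel `c` of delay `n`. -/
abbrev CSig : Type := (c : Fin P.chans) × Fin (P.delay c + 1)

/-- The parallel branches of the centralised program: the threads, and for each channel of delay `n`
the registers `0, ..., n - 1`. -/
abbrev CInst : Type := Fin P.threads ⊕ ((c : Fin P.chans) × Fin (P.delay c))

abbrev CProgram : Type u :=
  Esterel.Program P.CSig P.CInst (Port P.chans) (Var P.chans) H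

/-- A register: `loop emit out(pre(inp)); pause end`, preceded by an emission of the initial value if
there is one. -/
def register (c : Fin P.chans) (tok : Token H) : Module P.chans H where
  code :=
    let body : Code P.chans H := .loop (.seq (.emitPre (.out c) (.inp c)) .pause)
    match tok with
    | none => body
    | some v => .seq (.emit (.out c) (.const v)) body
  mem := initMem

/-- The centralised target: the sender of a channel `c` of delay `n` writes `c_0`, its receiver reads
`c_n`, and register `k` copies `pre(c_k)` to `c_(k+1)`. -/
def centralised : P.CProgram where
  bind
    | .inl _, .inp c => ⟨c, Fin.last _⟩
    | .inl _, .out c => ⟨c, 0⟩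
    | .inr ⟨c, k⟩, .inp _ => ⟨c, k.castSucc⟩
    | .inr ⟨c, k⟩, .out _ => ⟨c, k.succ⟩
  inst
    | .inl i => P.threadModule i
    | .inr ⟨c, k⟩ => P.register c (P.init c k.rev)
  pre _ := none

/-- An execution of the centralised target: a sequence of reactions of the closed Esterel program,
where `sig k` are the statuses of the signals in instant `k`. -/
@[ext]
structure CentralExec : Type u where
  state : ℕ → P.CProgram
  sig : ℕ → P.CSig → Token H
  start : state 0 = P.centralised
  step : ∀ k, (state k).Reacts (fun _ => False) (sig k) (state (k + 1))

/-! ### Equivalence of executions -/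

/-- The reactions of each thread in a distributed execution are those of the centralised execution at
the same logical clock: same residual statement and datastore (before and after each reaction), same
tokens read from the inbound channels, same tokens written to the outbound channels. -/
structure Corresponds {P : Program H} (D : P.DistExec) (X : P.CentralExec) : Prop where
  state : ∀ t i, ((D.state t).prog i).inst () = (X.state ((D.state t).clock i)).inst (.inl i)
  input : ∀ t, ∀ i ∈ D.fires t, ∀ c, P.dst c = i →
    D.sig t i (.inp c) = X.sig ((D.state t).clock i) ⟨c, Fin.last _⟩
  output : ∀ t, ∀ i ∈ D.fires t, ∀ c, P.src c = i →
    D.sig t i (.out c) = X.sig ((D.state t).clock i) ⟨c, 0⟩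

/-- Two distributed executions are the same up to step `T`. -/
def DistExec.AgreeUpTo {P : Program H} (T : ℕ) (D D' : P.DistExec) : Prop :=
  (∀ t ≤ T, D'.state t = D.state t) ∧ ∀ t < T, D'.fires t = D.fires t ∧ D'.sig t = D.sig t

end Program

end Timetide

/-!
The two targets run the same modules, so everything follows from two properties of one reaction of a
module (`ThreadCode.react`): it exists, and it is a function of the tokens on the inbound channels.
They are proved for the statements of a certain shape, `ThreadCode`, which contains the translations
of the kernel statements (`ThreadCode.toEsterel`) and is closed under taking residuals. Guarded loops
provide the existence of a reaction, bound labels exclude exits to the outside, and since mailboxes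
are flushed only directly before a pause, each output signal is emitted at most once per instant.
Hence one instant of a thread is a deterministic map (`ThreadStep`) from input tokens to the next
state and output tokens.

In the centralised target, registers make the tokens received from channels of positive delay known
at the beginning of an instant. The outputs of the threads therefore solve a system of equations whose
dependencies are the channels of delay `0`. These have no cycle, so the solution exists and is unique
(`existsUnique_fixedPoint`, `CentralInv.reacts`), which makes the centralised execution unique. Its
registers turn the output of a sender in instant `k` into the input of the receiver in instant
`k + delay c`, and provide the initial tokens before (`CentralExec.received_add_delay`,
`CentralExec.received_of_lt`).

The distributed target is a Kahn network whose histories are those of the centralised execution: by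
induction on the number of steps, the FIFO of a channel holds the tokens of the centralised execution
from the clock of its receiver up to the clock of its sender plus the delay, and each thread is in its
state at its clock (`DistInv`). In a fair execution the clocks diverge, by induction on the clock and,
for equal clocks, along the channels of delay `0` (`DistExec.Fair.exists_le_clock`). Since any set of
ready threads can make a tick (`DistInv.exists_step`), every finite part of an execution extends to a
fair one, in which from some step on all ready threads make a tick.
-/

namespace Timetide

/-! ### Reactions of thread code -/

/-- First component: the statement may terminate in the instant in which it is started. Second
component: the labels of the traps that it may exit in that instant. Both are over-approximated by
ignoring the values of conditions; this is `Timetide.Stmt.mayEndExit` on the level of Esterel. -/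
def Esterel.Stmt.mayEndExit {S X : Type} {H : Type*} : Esterel.Stmt S X H → Prop × Set ℕ
  | .pause => (False, ∅)
  | .present _ _ p q => (p.mayEndExit.1 ∨ q.mayEndExit.1, p.mayEndExit.2 ∪ q.mayEndExit.2)
  | .ite _ p q => (p.mayEndExit.1 ∨ q.mayEndExit.1, p.mayEndExit.2 ∪ q.mayEndExit.2)
  | .seq p q => (p.mayEndExit.1 ∧ q.mayEndExit.1,
      p.mayEndExit.2 ∪ {L | p.mayEndExit.1 ∧ L ∈ q.mayEndExit.2})
  | .loop p => (False, p.mayEndExit.2)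
  | .trap L p => (p.mayEndExit.1 ∨ L ∈ p.mayEndExit.2, p.mayEndExit.2 \ {L})
  | .exit L => (False, {L})
  | _ => (True, ∅)

/-- The shape of the code of a thread at any time, that is, of the translation of a kernel statement
and of its residuals. Inputs are read on `ins` only, exits stay within `scope`, loop bodies do not
terminate instantly, and mailboxes are flushed only directly before a pause. -/
inductive ThreadCode {m : ℕ} {H : Type*} (ins outs : List (Fin m)) : Set ℕ → Code m H → Prop
  | nothing {scope} : ThreadCode ins outs scope .nothing
  | assign {scope} (x e) : ThreadCode ins outs scope (.assign x e)
  | present {scope} {c : Fin m} (x) {p q} : c ∈ ins → ThreadCode ins outs scope p →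
      ThreadCode ins outs scope q → ThreadCode ins outs scope (.present (.inp c) x p q)
  | ite {scope} (e) {p q} : ThreadCode ins outs scope p → ThreadCode ins outs scope q →
      ThreadCode ins outs scope (.ite e p q)
  | seq {scope p q} : ThreadCode ins outs scope p → ThreadCode ins outs scope q →
      ThreadCode ins outs scope (.seq p q)
  | flushPause {scope p} : ThreadCode ins outs scope p →
      ThreadCode ins outs scope (.seq (flush outs) (.seq .pause p))
  | loop {scope p} : ¬ p.mayEndExit.1 → ThreadCode ins outs scope p →
      ThreadCode ins outs scope (.loop p)
  | trap {scope L p} : ThreadCode ins outs (insert L scope) p → ThreadCode ins outs scope (.trap L p)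
  | exit {scope L} : L ∈ scope → ThreadCode ins outs scope (.exit L)

/-- The emissions `o` are given by one token `w c` for every channel `c` in `outs`. In particular, no
output signal is emitted with two different values. -/
def Emits {m : ℕ} {H : Type*} (outs : List (Fin m)) (o : List (Port m × Value H))
    (w : Fin m → Token H) : Prop :=
  ∀ s v, (s, v) ∈ o ↔ ∃ c ∈ outs, s = .out c ∧ w c = some v

/-- What `ThreadCode` guarantees about the completion of an instant: it emits only if it pauses, and
the residual is thread code again. -/
def OutcomeOK {m : ℕ} {H : Type*} (ins outs : List (Fin m)) (scope : Set ℕ) (p : Code m H) :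
    Esterel.Outcome (Port m) (Var m) H → Prop
  | .done _ o => o = [] ∧ p.mayEndExit.1
  | .pause p' _ o => ThreadCode ins outs scope p' ∧ ∃ w, Emits outs o w
  | .exit L _ o => o = [] ∧ L ∈ p.mayEndExit.2 ∧ L ∈ scope

section
variable {m : ℕ} {H : Type*}

/-- Each mailbox is flushed at most once as `outs` has no duplicates. -/
lemma flush_react {outs : List (Fin m)} (h : outs.Nodup) (μ : Var m → Value H) :
    ∃ μ' o, (∀ E, (flush outs).react E μ = some (.done μ' o)) ∧
      Emits outs o fun c => if (μ (.full c)).isTrue then some (μ (.box c)) else none := by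
  induction outs generalizing μ with
  | nil => exact ⟨μ, [], fun _ => rfl, fun s v => by simp⟩
  | cons c cs ih =>
    obtain ⟨hc, hcs⟩ := List.nodup_cons.1 h
    by_cases hf : (μ (.full c)).isTrue
    · obtain ⟨μ', o, hr, ho⟩ := ih hcs (Function.update μ (.full c) (.bool false))
      refine ⟨μ', (.out c, μ (.box c)) :: o, fun E => ?_, fun s v => ?_⟩
      · have := hr E
        simp only [flush] at this
        simp [flush, Esterel.Stmt.seqs, Esterel.Stmt.react, Esterel.Expr.eval, hf,
          Esterel.Outcome.emitFirst, this]
      · simp only [List.mem_cons, ho s v, Prod.mk.injEq]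
        constructor
        · rintro (⟨rfl, rfl⟩ | ⟨c', h', rfl, hw⟩)
          · exact ⟨c, .inl rfl, rfl, by simp [hf]⟩
          · have : c' ≠ c := fun e => hc (e ▸ h')
            refine ⟨c', .inr h', rfl, ?_⟩
            simpa [Function.update, this] using hw
        · rintro ⟨c', rfl | h', rfl, hw⟩
          · left; simpa [hf, eq_comm] using hw
          · have : c' ≠ c := fun e => hc (e ▸ h')
            exact .inr ⟨c', h', rfl, by simpa [Function.update, this] using hw⟩
    · obtain ⟨μ', o, hr, ho⟩ := ih hcs μ
      refine ⟨μ', o, fun E => ?_, fun s v => ?_⟩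
      · have := hr E
        simp only [flush] at this
        simp [flush, Esterel.Stmt.seqs, Esterel.Stmt.react, Esterel.Expr.eval, hf,
          Esterel.Outcome.emitFirst, this]
      · rw [ho s v]
        constructor
        · rintro ⟨c', h', rfl, hw⟩
          exact ⟨c', List.mem_cons_of_mem _ h', rfl, hw⟩
        · rintro ⟨c', h', rfl, hw⟩
          rcases List.mem_cons.1 h' with rfl | h'
          · simp [hf] at hw
          · exact ⟨c', h', rfl, hw⟩

/-- Thread code reacts, and its reaction is determined by the inputs `x` on `ins`: it does not depend
on the other signals nor on the previous statuses. -/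
lemma ThreadCode.react {ins outs : List (Fin m)} {scope : Set ℕ} {p : Code m H}
    (hp : ThreadCode ins outs scope p) (hout : outs.Nodup) (x : Fin m → Token H)
    (μ : Var m → Value H) :
    ∃ r, OutcomeOK ins outs scope p r ∧
      ∀ E : Esterel.Env (Port m) H, (∀ c ∈ ins, E.cur (.inp c) = x c) → p.react E μ = some r := by
  induction hp generalizing μ with
  | nothing => exact ⟨.done μ [], ⟨rfl, trivial⟩, fun _ _ => rfl⟩
  | assign y e =>
    exact ⟨.done (Function.update μ y (e.eval μ)) [], ⟨rfl, trivial⟩, fun _ _ => rfl⟩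
  | exit h => exact ⟨.exit _ μ [], ⟨rfl, rfl, h⟩, fun _ _ => rfl⟩
  | @present scope c y p q hc _ _ ihp ihq =>
    cases hx : x c with
    | none =>
      obtain ⟨r, hr, h⟩ := ihq μ
      refine ⟨r, ?_, fun E hE => by simp [Esterel.Stmt.react, hE c hc, hx, h E hE]⟩
      cases r <;> simp_all [OutcomeOK, Esterel.Stmt.mayEndExit]
    | some v =>
      obtain ⟨r, hr, h⟩ := ihp (Function.update μ y v)
      refine ⟨r, ?_, fun E hE => by simp [Esterel.Stmt.react, hE c hc, hx, h E hE]⟩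
      cases r <;> simp_all [OutcomeOK, Esterel.Stmt.mayEndExit]
  | @ite scope e p q _ _ ihp ihq =>
    by_cases he : (e.eval μ).isTrue
    · obtain ⟨r, hr, h⟩ := ihp μ
      refine ⟨r, ?_, fun E hE => by simp [Esterel.Stmt.react, he, h E hE]⟩
      cases r <;> simp_all [OutcomeOK, Esterel.Stmt.mayEndExit]
    · obtain ⟨r, hr, h⟩ := ihq μ
      refine ⟨r, ?_, fun E hE => by simp [Esterel.Stmt.react, he, h E hE]⟩
      cases r <;> simp_all [OutcomeOK, Esterel.Stmt.mayEndExit]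
  | @seq scope p q _ hq ihp ihq =>
    obtain ⟨r, hr, h⟩ := ihp μ
    rcases r with ⟨μ', o⟩ | ⟨p', μ', o⟩ | ⟨L, μ', o⟩
    · obtain ⟨rfl, hp⟩ := hr
      obtain ⟨r, hr, h'⟩ := ihq μ'
      refine ⟨r, ?_, fun E hE => ?_⟩
      · cases r <;> simp_all [OutcomeOK, Esterel.Stmt.mayEndExit]
      · cases r <;> simp [Esterel.Stmt.react, h E hE, h' E hE, Esterel.Outcome.emitFirst]
    · exact ⟨.pause (.seq p' q) μ' o, ⟨hr.1.seq hq, hr.2⟩,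
        fun E hE => by simp [Esterel.Stmt.react, h E hE]⟩
    · exact ⟨.exit L μ' o, ⟨hr.1, .inl hr.2.1, hr.2.2⟩,
        fun E hE => by simp [Esterel.Stmt.react, h E hE]⟩
  | @flushPause scope p hp _ =>
    obtain ⟨μ', o, h, ho⟩ := flush_react hout μ
    exact ⟨.pause (.seq .nothing p) μ' o, ⟨ThreadCode.nothing.seq hp, _, ho⟩,
      fun E _ => by simp [Esterel.Stmt.react, h E, Esterel.Outcome.emitFirst]⟩
  | @loop scope p hd hp ih =>
    obtain ⟨r, hr, h⟩ := ih μ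
    rcases r with ⟨μ', o⟩ | ⟨p', μ', o⟩ | ⟨L, μ', o⟩
    · exact absurd hr.2 hd
    · exact ⟨.pause (.seq p' (.loop p)) μ' o, ⟨hr.1.seq (hp.loop hd), hr.2⟩,
        fun E hE => by simp [Esterel.Stmt.react, h E hE]⟩
    · exact ⟨.exit L μ' o, hr, fun E hE => by simp [Esterel.Stmt.react, h E hE]⟩
  | @trap scope L p hp ih =>
    obtain ⟨r, hr, h⟩ := ih μ
    rcases r with ⟨μ', o⟩ | ⟨p', μ', o⟩ | ⟨L', μ', o⟩
    · exact ⟨.done μ' o, ⟨hr.1, .inl hr.2⟩, fun E hE => by simp [Esterel.Stmt.react, h E hE]⟩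
    · exact ⟨.pause (.trap L p') μ' o, ⟨hr.1.trap, hr.2⟩,
        fun E hE => by simp [Esterel.Stmt.react, h E hE]⟩
    · by_cases hL : L' = L
      · exact ⟨.done μ' o, ⟨hr.1, .inr (hL ▸ hr.2.1)⟩,
          fun E hE => by simp [Esterel.Stmt.react, h E hE, hL]⟩
      · exact ⟨.exit L' μ' o, ⟨hr.1, ⟨hr.2.1, hL⟩, hr.2.2.resolve_left hL⟩,
          fun E hE => by simp [Esterel.Stmt.react, h E hE, hL]⟩

lemma ThreadCode.tick {ins outs : List (Fin m)} {M : Module m H}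
    (hM : ThreadCode ins outs ∅ M.code) (hout : outs.Nodup) (x : Fin m → Token H) :
    ∃ (M' : Module m H) (o : List (Port m × Value H)) (w : Fin m → Token H),
      ThreadCode ins outs ∅ M'.code ∧ Emits outs o w ∧
      ∀ E : Esterel.Env (Port m) H, (∀ c ∈ ins, E.cur (.inp c) = x c) →
        M.tick E = some (M', o) := by
  obtain ⟨r, hr, h⟩ := hM.react hout x M.mem
  rcases r with ⟨μ', o⟩ | ⟨p', μ', o⟩ | ⟨L, μ', o⟩
  · exact ⟨⟨.nothing, μ'⟩, o, fun _ => none, .nothing, by simp [Emits, hr.1],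
      fun E hE => by simp [Esterel.ModState.tick, h E hE]⟩
  · obtain ⟨hp', w, hw⟩ := hr
    exact ⟨⟨p', μ'⟩, o, w, hp', hw, fun E hE => by simp [Esterel.ModState.tick, h E hE]⟩
  · exact absurd hr.2.2 (Set.notMem_empty L)

/-! ### The translation yields thread code -/

lemma ThreadCode.seqs {ins outs : List (Fin m)} {scope : Set ℕ} {l : List (Code m H)}
    (h : ∀ p ∈ l, ThreadCode ins outs scope p) : ThreadCode ins outs scope (.seqs l) := by
  induction l with
  | nil => exact .nothing
  | cons p l ih =>
    exact (h p (by simp)).seq (ih fun q hq => h q (by simp [hq]))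

lemma ThreadCode.unfresh (ins outs : List (Fin m)) (scope : Set ℕ) (e : Expr m H) :
    ThreadCode ins outs scope e.unfresh := by
  refine .seqs fun p hp => ?_
  obtain ⟨c, -, rfl⟩ := List.mem_map.1 hp
  exact .assign _ _

lemma ThreadCode.receive (ins outs : List (Fin m)) (scope : Set ℕ) :
    ThreadCode (H := H) ins outs scope (receive ins) := by
  refine .seqs fun p hp => ?_
  obtain ⟨c, hc, rfl⟩ := List.mem_map.1 hp
  exact .present _ hc (.assign _ _) .nothing

lemma mayEndExit_seqs {l : List (Code m H)} (h : ∀ p ∈ l, p.mayEndExit.2 = ∅) :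
    (Esterel.Stmt.seqs l).mayEndExit.2 = ∅ := by
  induction l with
  | nil => rfl
  | cons p l ih =>
    simp [Esterel.Stmt.seqs, Esterel.Stmt.mayEndExit, h p, ih fun q hq => h q (by simp [hq])]

lemma mayEndExit_unfresh (e : Expr m H) : e.unfresh.mayEndExit.2 = ∅ :=
  mayEndExit_seqs <| by simp [Esterel.Stmt.mayEndExit]

lemma mayEndExit_receive (ins : List (Fin m)) :
    (receive (H := H) ins).mayEndExit.2 = ∅ :=
  mayEndExit_seqs <| by simp [Esterel.Stmt.mayEndExit]

lemma mayEndExit_flush (outs : List (Fin m)) : (flush (H := H) outs).mayEndExit.2 = ∅ :=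
  mayEndExit_seqs <| by simp [Esterel.Stmt.mayEndExit]

/-- The translation terminates or exits instantly only where the kernel statement may do so. -/
lemma mayEndExit_toEsterel (ins outs : List (Fin m)) (t : Stmt m H) :
    ((t.toEsterel ins outs).mayEndExit.1 → t.mayEndExit.1) ∧
      (t.toEsterel ins outs).mayEndExit.2 ⊆ t.mayEndExit.2 := by
  induction t with
  | sync d =>
    refine ⟨?_, (mayEndExit_seqs ?_).subset⟩
    · cases d <;>
        simp [Stmt.toEsterel, Stmt.mayEndExit, List.replicate, Esterel.Stmt.seqs,
          Esterel.Stmt.mayEndExit]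
    · intro p hp
      rw [List.eq_of_mem_replicate hp]
      refine mayEndExit_seqs ?_
      simp [mayEndExit_flush, mayEndExit_receive, Esterel.Stmt.mayEndExit]
  | ite e t u iht ihu =>
    simp only [Stmt.toEsterel, Stmt.mayEndExit, Esterel.Stmt.mayEndExit, mayEndExit_unfresh,
      Set.empty_union]
    refine ⟨Or.imp (fun h => iht.1 h.2) (fun h => ihu.1 h.2), Set.union_subset_union ?_ ?_⟩
    · exact fun L h => iht.2 h.2
    · exact fun L h => ihu.2 h.2
  | loop t ih => exact ⟨id, ih.2⟩
  | seq t u iht ihu =>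
    exact ⟨And.imp iht.1 ihu.1, Set.union_subset_union iht.2 fun L h => ⟨iht.1 h.1, ihu.2 h.2⟩⟩
  | abort L t ih =>
    exact ⟨Or.imp ih.1 (@ih.2 L), Set.sdiff_subset_sdiff_left ih.2⟩
  | checkabort e L =>
    refine ⟨fun _ => trivial, ?_⟩
    simp only [Stmt.toEsterel, Stmt.mayEndExit, Esterel.Stmt.mayEndExit, mayEndExit_unfresh,
      Set.empty_union, Set.union_empty]
    exact fun L h => h.2
  | _ =>
    refine ⟨fun _ => trivial, ?_⟩
    simp [Stmt.toEsterel, Esterel.Stmt.seqs, Esterel.Stmt.mayEndExit, mayEndExit_unfresh]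

lemma ThreadCode.toEsterel (ins outs : List (Fin m)) {scope : Set ℕ} {t : Stmt m H}
    (hl : t.LoopsGuarded) (hb : t.LabelsBound scope) :
    ThreadCode ins outs scope (t.toEsterel ins outs) := by
  induction t generalizing scope with
  | nothing => exact .nothing
  | assign y e => exact (ThreadCode.assign _ _).seq (.unfresh _ _ _ _)
  | varDecl y => exact .assign _ _
  | expr e => exact .unfresh _ _ _ _
  | send c e =>
    refine .seqs ?_
    simp only [List.forall_mem_cons]
    exact ⟨.assign _ _, .assign _ _, .unfresh _ _ _ _, by simp⟩
  | sync d =>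
    refine .seqs fun p hp => ?_
    rw [List.eq_of_mem_replicate hp]
    exact .flushPause ((ThreadCode.receive _ _ _).seq .nothing)
  | ite e t u iht ihu =>
    exact .ite _ ((ThreadCode.unfresh _ _ _ _).seq (iht hl.1 hb.1))
      ((ThreadCode.unfresh _ _ _ _).seq (ihu hl.2 hb.2))
  | loop t ih => exact .loop (mt (mayEndExit_toEsterel _ _ t).1 hl.1) (ih hl.2 hb)
  | seq t u iht ihu => exact (iht hl.1 hb.1).seq (ihu hl.2 hb.2)
  | checkabort e L =>
    exact .ite _ ((ThreadCode.unfresh _ _ _ _).seq (.exit hb)) (.unfresh _ _ _ _)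
  | abort L t ih => exact .trap (ih hl hb)

end

/-! ### Instants of the centralised target -/

/-- A system of equations in which the equation for `a` involves only unknowns that precede `a` in a
well-founded relation has exactly one solution. -/
lemma existsUnique_fixedPoint {α β : Type*} [Nonempty β] {R : α → α → Prop} (hR : WellFounded R)
    (G : (α → β) → α → β)
    (hG : ∀ a y y', (∀ b, R b a → y b = y' b) → G y a = G y' a) : ∃! y, G y = y := by
  classical
  let F : ∀ a, (∀ b, R b a → β) → β :=
    fun a rec => G (fun b => if h : R b a then rec b h else Classical.arbitrary β) a
  refine ⟨hR.fix F, ?_, fun y hy => ?_⟩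
  · funext a
    rw [hR.fix_eq]
    exact hG a _ _ fun b hb => by simp [hb]
  · funext a
    induction a using hR.induction with
    | _ a ih =>
      rw [hR.fix_eq, ← hy]
      exact hG a _ _ fun b hb => by simp [hb, ih b hb]

namespace Program

variable {H : Type*} {P : Program H}

/-- Thread `i` depends on thread `j` within an instant if a channel of delay `0` leads from `j`
to `i`. -/
def ZeroDelay (P : Program H) (j i : Fin P.threads) : Prop :=
  ∃ c, P.src c = j ∧ P.dst c = i ∧ P.delay c = 0

lemma WellFormed.wellFounded_zeroDelay (hP : P.WellFormed) : WellFounded P.ZeroDelay := by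
  have : Std.Irrefl (Relation.TransGen P.ZeroDelay) := ⟨hP.causal⟩
  exact Subrelation.wf Relation.TransGen.single
    (Finite.wellFounded_of_trans_of_irrefl (Relation.TransGen P.ZeroDelay))

lemma mem_ins {i : Fin P.threads} {c : Fin P.chans} : c ∈ P.ins i ↔ P.dst c = i := by
  simp [ins]

lemma mem_outs {i : Fin P.threads} {c : Fin P.chans} : c ∈ P.outs i ↔ P.src c = i := by
  simp [outs]

lemma nodup_outs (i : Fin P.threads) : (P.outs i).Nodup :=
  (List.nodup_finRange _).filter _

/-- With the tokens `x` on its inbound channels, thread `i` goes in one instant from `M` to `M'`,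
which is again in the state of a thread, and puts the tokens `y` on its outbound channels. -/
def ThreadStep (P : Program H) (i : Fin P.threads) (M : Module P.chans H)
    (x : Fin P.chans → Token H) (M' : Module P.chans H) (y : Fin P.chans → Token H) : Prop :=
  ThreadCode (P.ins i) (P.outs i) ∅ M'.code ∧ ∃ o, Emits (P.outs i) o y ∧
    ∀ E : Esterel.Env (Port P.chans) H, (∀ c, P.dst c = i → E.cur (.inp c) = x c) →
      M.tick E = some (M', o)

lemma exists_threadStep {i : Fin P.threads} {M : Module P.chans H}
    (h : ThreadCode (P.ins i) (P.outs i) ∅ M.code) (x : Fin P.chans → Token H) :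
    ∃ M' y, P.ThreadStep i M x M' y := by
  obtain ⟨M', o, y, hM', ho, ht⟩ := h.tick (nodup_outs i) x
  exact ⟨M', y, hM', o, ho, fun E hE => ht E fun c hc => hE c (mem_ins.1 hc)⟩

lemma ThreadStep.output_unique {i : Fin P.threads} {M M₁ M₂ : Module P.chans H}
    {x₁ x₂ y₁ y₂ : Fin P.chans → Token H} (h₁ : P.ThreadStep i M x₁ M₁ y₁)
    (h₂ : P.ThreadStep i M x₂ M₂ y₂) (hx : ∀ c, P.dst c = i → x₁ c = x₂ c) {c : Fin P.chans}
    (hc : P.src c = i) : y₁ c = y₂ c := by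
  obtain ⟨-, o₁, ho₁, ht₁⟩ := h₁
  obtain ⟨-, o₂, ho₂, ht₂⟩ := h₂
  let E : Esterel.Env (Port P.chans) H :=
    ⟨fun | .inp c => x₁ c | .out _ => none, fun _ => none⟩
  have := (ht₁ E fun _ _ => rfl).symm.trans (ht₂ E hx)
  obtain rfl : o₁ = o₂ := by simpa using congrArg (Option.map Prod.snd) this
  ext v
  have e := (ho₁ (.out c) v).symm.trans (ho₂ (.out c) v)
  have hc := mem_outs.2 hc
  simp only [Port.out.injEq] at e
  constructor
  · intro h
    obtain ⟨_, -, rfl, h⟩ := e.1 ⟨c, hc, rfl, h⟩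
    exact h
  · intro h
    obtain ⟨_, -, rfl, h⟩ := e.2 ⟨c, hc, rfl, h⟩
    exact h

/-- A register after its first instant. -/
def runningRegister (P : Program H) (c : Fin P.chans) : Module P.chans H where
  code := .seq .nothing (.loop (.seq (.emitPre (.out c) (.inp c)) .pause))
  mem := initMem

/-- The invariant of the centralised target between instants: each thread is in the state of a
thread, and register `k` of channel `c` is about to emit the token `r ⟨c, k⟩` (which comes from the
initial value in the first instant, and from `pre` later on). -/
structure CentralInv (A : P.CProgram) (r : ((c : Fin P.chans) × Fin (P.delay c)) → Token H) :
    Prop where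
  bind : A.bind = P.centralised.bind
  thread : ∀ i, ThreadCode (P.ins i) (P.outs i) ∅ (A.inst (.inl i)).code
  reg : ∀ c k,
    A.inst (.inr ⟨c, k⟩) = P.register c (r ⟨c, k⟩) ∧ A.pre ⟨c, k.castSucc⟩ = none ∨
    A.inst (.inr ⟨c, k⟩) = P.runningRegister c ∧ A.pre ⟨c, k.castSucc⟩ = r ⟨c, k⟩

lemma CentralInv.register_tick {A : P.CProgram} {r} (hA : CentralInv A r) (c : Fin P.chans)
    (k : Fin (P.delay c)) (E : Esterel.Env (Port P.chans) H)
    (hE : E.pre (.inp c) = A.pre ⟨c, k.castSucc⟩) :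
    (A.inst (.inr ⟨c, k⟩)).tick E =
      some (P.runningRegister c, ((r ⟨c, k⟩).map (Prod.mk (Port.out c))).toList) := by
  have hreg := hA.reg c k
  cases hr : r ⟨c, k⟩ <;> rw [hr] at hreg <;> obtain ⟨h, hn⟩ | ⟨h, hn⟩ := hreg <;>
    simp [h, hE, hn, register, runningRegister, Esterel.ModState.tick, Esterel.Stmt.react,
      Esterel.Outcome.emitFirst, Esterel.Expr.eval]

/-- The signal statuses of the centralised target in an instant in which `y c` is put on channel `c`
and the registers emit `r`. -/
def statuses (P : Program H) (y : Fin P.chans → Token H)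
    (r : ((c : Fin P.chans) × Fin (P.delay c)) → Token H) (s : P.CSig) : Token H :=
  Fin.cases (motive := fun _ => Token H) (y s.1) (fun k => r ⟨s.1, k⟩) s.2

/-- If thread `i` emits `w i` and the registers emit `r`, then there is exactly one coherent
assignment of statuses. -/
lemma coherent_iff {out : P.CInst → List (Port P.chans × Value H)}
    {w : Fin P.threads → Fin P.chans → Token H}
    {r : ((c : Fin P.chans) × Fin (P.delay c)) → Token H}
    (hw : ∀ i, Emits (P.outs i) (out (.inl i)) (w i))
    (hr : ∀ c k, out (.inr ⟨c, k⟩) = ((r ⟨c, k⟩).map (Prod.mk (Port.out c))).toList)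
    (E : P.CSig → Token H) :
    (∀ s, ¬ False → ∀ v, E s = some v ↔ ∃ i p, P.centralised.bind i p = s ∧ (p, v) ∈ out i) ↔
      E = P.statuses (fun c => w (P.src c) c) r := by
  have key : ∀ s v, (∃ i p, P.centralised.bind i p = s ∧ (p, v) ∈ out i) ↔
      P.statuses (fun c => w (P.src c) c) r s = some v := by
    rintro ⟨c, k⟩ v
    constructor
    · rintro ⟨i | ⟨c', k'⟩, p, hb, hp⟩
      · obtain ⟨c', hc', rfl, h⟩ := (hw i p v).1 hp
        cases hb
        rw [mem_outs] at hc'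
        simpa [statuses, hc'] using h
      · rw [hr] at hp
        simp only [Option.mem_toList, Option.map_eq_some_iff, Prod.mk.injEq] at hp
        obtain ⟨_, h, rfl, rfl⟩ := hp
        cases hb
        simpa [statuses] using h
    · intro h
      induction k using Fin.cases with
      | zero =>
        exact ⟨.inl (P.src c), .out c, rfl, (hw _ _ _).2 ⟨c, mem_outs.2 rfl, rfl, h⟩⟩
      | succ k =>
        refine ⟨.inr ⟨c, k⟩, .out c, rfl, ?_⟩
        rw [hr]
        simpa [statuses] using h
  simp only [key, not_false_eq_true, forall_const]
  exact ⟨fun h => funext fun s => Option.ext fun v => h s v, by rintro rfl; simp⟩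

/-- One instant of the centralised target. The statuses are a fixed point of the map that sends the
outputs of the threads to their reaction; it is unique since there is no cycle of channels of
delay `0`. -/
theorem CentralInv.reacts (hP : P.WellFormed) {A : P.CProgram} {r} (hA : CentralInv A r) :
    ∃ E B, A.Reacts (fun _ => False) E B ∧
      (∀ E' B', A.Reacts (fun _ => False) E' B' → E' = E ∧ B' = B) ∧
      (∀ c k, E ⟨c, Fin.succ k⟩ = r ⟨c, k⟩) ∧
      CentralInv B (fun k => E ⟨k.1, k.2.castSucc⟩) ∧
      ∀ i, P.ThreadStep i (A.inst (.inl i)) (fun c => E ⟨c, Fin.last _⟩) (B.inst (.inl i))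
        (fun c => E ⟨c, 0⟩) := by
  choose M Y hMY using fun i x => exists_threadStep (hA.thread i) x
  let inputs (y : Fin P.chans → Token H) (c : Fin P.chans) : Token H :=
    P.statuses y r ⟨c, Fin.last _⟩
  let G (y : Fin P.chans → Token H) (c : Fin P.chans) : Token H := Y (P.src c) (inputs y) c
  obtain ⟨y, hy, huniq⟩ := existsUnique_fixedPoint
    (InvImage.wf P.src hP.wellFounded_zeroDelay) G <| by
      refine fun c y y' h => (hMY _ _).output_unique (hMY _ _) (fun b hb => ?_) rfl
      simp only [inputs, statuses]
      by_cases h0 : P.delay b = 0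
      · have : Fin.last (P.delay b) = 0 := Fin.ext h0
        simpa [this] using h b ⟨b, rfl, hb, h0⟩
      · obtain ⟨k, hk⟩ := Fin.exists_succ_eq.2
          (show Fin.last (P.delay b) ≠ 0 from fun e => h0 (congrArg Fin.val e))
        simp [← hk]
  choose hM o ho ht using hMY
  have hEy : P.statuses (fun c => Y (P.src c) (inputs y) c) r = P.statuses y r :=
    congrArg (fun z => P.statuses z r) hy
  let B : P.CProgram :=
    { bind := A.bind
      inst := fun
        | .inl i => M i (inputs y)
        | .inr ⟨c, _⟩ => P.runningRegister c
      pre := P.statuses y r }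
  have hB : ∀ i, P.ThreadStep i (A.inst (.inl i)) (inputs y) (M i (inputs y))
      (fun c => P.statuses y r ⟨c, 0⟩) := by
    refine fun i => ⟨hM _ _, o i (inputs y), fun s v => (ho _ _ s v).trans ?_, ht i _⟩
    refine exists_congr fun c => and_congr_right fun hc => ?_
    have hc := mem_outs.1 hc
    have : Y i (inputs y) c = y c := hc ▸ congrFun hy c
    simp [statuses, this]
  refine ⟨P.statuses y r, B, ?_, ?_, fun c k => by simp [statuses], ⟨hA.bind, fun i => hM i _,
    fun c k => .inr ⟨rfl, rfl⟩⟩, hB⟩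
  · refine ⟨fun
      | .inl i => o i (inputs y)
      | .inr k => ((r k).map (Prod.mk (Port.out k.1))).toList, ?_, ?_, rfl, rfl⟩
    · rintro (i | ⟨c, k⟩)
      · exact ht _ _ _ fun c _ => by simp only [hA.bind]; rfl
      · exact hA.register_tick c k _ (by simp only [hA.bind]; rfl)
    · rw [hA.bind]
      exact (coherent_iff (fun i => ho i (inputs y)) (fun _ _ => rfl) _).2 hEy.symm
  · rintro E' B' ⟨out, ht', hE', hbind, hpre⟩
    have hreg := fun c k => (ht' (.inr ⟨c, k⟩)).symm.trans
      (hA.register_tick c k _ (by simp only [hA.bind]; rfl))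
    have hthread := fun i => (ht' (.inl i)).symm.trans
      (ht i (fun c => E' ⟨c, Fin.last _⟩) _ fun c _ => by simp only [hA.bind]; rfl)
    simp only [Option.some.injEq, Prod.mk.injEq] at hreg hthread
    rw [hA.bind] at hE'
    have hE := (coherent_iff (fun i => (hthread i).2 ▸ ho i _) (fun c k => (hreg c k).2) _).1 hE'
    -- The outputs in any other reaction solve the same system of equations.
    have hyE : (fun c => E' ⟨c, 0⟩) = y := by
      refine huniq _ (funext fun c => ?_)
      have h0 : E' ⟨c, 0⟩ = Y (P.src c) (fun c => E' ⟨c, Fin.last _⟩) c := by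
        conv_lhs => rw [hE]
        simp [statuses]
      have : inputs (fun c => E' ⟨c, 0⟩) = fun c => E' ⟨c, Fin.last _⟩ := by
        funext b
        have e := congrFun hE ⟨b, Fin.last _⟩
        rw [e]
        simp only [inputs]
        congr 1
        funext c
        conv_lhs => rw [hE]
        simp [statuses]
      change Y (P.src c) (inputs _) c = _
      rw [this, h0]
    have hEE : E' = P.statuses y r := by
      rw [hE, ← hyE]
      congr 1
      funext c
      conv_rhs => rw [hE]
      simp [statuses]
    refine ⟨hEE, ?_⟩
    obtain ⟨bind', inst', pre'⟩ := B'
    obtain rfl : bind' = A.bind := hbind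
    obtain rfl : pre' = E' := hpre
    have : inst' = B.inst := by
      funext j
      rcases j with i | ⟨c, k⟩
      · exact (hthread i).1.trans (by rw [hEE])
      · exact (hreg c k).1
    rw [this, hEE]

/-! ### The centralised execution -/

lemma centralInv_centralised (hP : P.WellFormed) :
    CentralInv P.centralised (fun k => P.init k.1 k.2.rev) where
  bind := rfl
  thread i := (ThreadCode.receive _ _ _).seq (.toEsterel _ _ (hP.loops i) (hP.labels i))
  reg _ _ := .inl ⟨rfl, rfl⟩

theorem exists_centralExec (hP : P.WellFormed) : Nonempty P.CentralExec := by
  have next : ∀ A : {A : P.CProgram // ∃ r, CentralInv A r}, ∃ (E : P.CSig → Token H)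
      (B : {A : P.CProgram // ∃ r, CentralInv A r}), A.1.Reacts (fun _ => False) E B.1 := by
    rintro ⟨A, r, hA⟩
    obtain ⟨E, B, h, -, -, hB, -⟩ := hA.reacts hP
    exact ⟨E, ⟨B, _, hB⟩, h⟩
  choose E B h using next
  let st : ℕ → {A : P.CProgram // ∃ r, CentralInv A r} :=
    fun k => B^[k] ⟨P.centralised, _, centralInv_centralised hP⟩
  refine ⟨⟨fun k => (st k).1, fun k => E (st k), rfl, fun k => ?_⟩⟩
  simp only [st, Function.iterate_succ_apply']
  exact h _

/-- The tokens that the registers emit in instant `k`. -/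
def CentralExec.regs (X : P.CentralExec) :
    ℕ → ((c : Fin P.chans) × Fin (P.delay c)) → Token H
  | 0, s => P.init s.1 s.2.rev
  | k + 1, s => X.sig k ⟨s.1, s.2.castSucc⟩

lemma CentralExec.inv (X : P.CentralExec) (hP : P.WellFormed) (k : ℕ) :
    CentralInv (X.state k) (X.regs k) := by
  induction k with
  | zero => exact X.start ▸ centralInv_centralised hP
  | succ k ih =>
    obtain ⟨E, B, -, h, -, hB, -⟩ := ih.reacts hP
    obtain ⟨hE, rfl⟩ := h _ _ (X.step k)
    subst hE
    exact hB

theorem CentralExec.unique (hP : P.WellFormed) (X Y : P.CentralExec) : Y = X := by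
  have step : ∀ k, Y.state k = X.state k →
      Y.sig k = X.sig k ∧ Y.state (k + 1) = X.state (k + 1) := by
    intro k hk
    obtain ⟨E, B, -, h, -⟩ := (X.inv hP k).reacts hP
    obtain ⟨h₁, h₂⟩ := h _ _ (X.step k)
    obtain ⟨h₃, h₄⟩ := h _ _ (hk ▸ Y.step k)
    exact ⟨h₃.trans h₁.symm, h₄.trans h₂.symm⟩
  have state : ∀ k, Y.state k = X.state k := by
    intro k
    induction k with
    | zero => rw [X.start, Y.start]
    | succ k ih => exact (step k ih).2
  exact CentralExec.ext (funext state) (funext fun k => (step k (state k)).1)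

lemma CentralExec.sig_succ (X : P.CentralExec) (hP : P.WellFormed) (k : ℕ) (c : Fin P.chans)
    (j : Fin (P.delay c)) : X.sig k ⟨c, j.succ⟩ = X.regs k ⟨c, j⟩ := by
  obtain ⟨E, B, -, h, hE, -⟩ := (X.inv hP k).reacts hP
  rw [(h _ _ (X.step k)).1, hE]

lemma CentralExec.threadStep (X : P.CentralExec) (hP : P.WellFormed) (k : ℕ)
    (i : Fin P.threads) :
    P.ThreadStep i ((X.state k).inst (.inl i)) (fun c => X.sig k ⟨c, Fin.last _⟩)
      ((X.state (k + 1)).inst (.inl i)) (fun c => X.sig k ⟨c, 0⟩) := by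
  obtain ⟨E, B, -, h, -, -, hE⟩ := (X.inv hP k).reacts hP
  obtain ⟨h₁, h₂⟩ := h _ _ (X.step k)
  rw [h₁, h₂]
  exact hE i

/-- The token that the receiver of channel `c` reads in instant `k`. -/
def CentralExec.received (X : P.CentralExec) (c : Fin P.chans) (k : ℕ) : Token H :=
  X.sig k ⟨c, Fin.last _⟩

/-- The registers delay the output of the sender by `delay c` instants. -/
lemma CentralExec.received_add_delay (X : P.CentralExec) (hP : P.WellFormed) (c : Fin P.chans)
    (k : ℕ) : X.received c (k + P.delay c) = X.sig k ⟨c, 0⟩ := by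
  have : ∀ j : Fin (P.delay c + 1), X.sig (k + j) ⟨c, j⟩ = X.sig k ⟨c, 0⟩ := by
    intro j
    induction j using Fin.induction with
    | zero => rfl
    | succ j ih => rw [X.sig_succ hP, ← ih]; rfl
  exact this (Fin.last _)

/-- An initial token moves from its register to the receiver. -/
lemma CentralExec.received_of_lt (X : P.CentralExec) (hP : P.WellFormed) (c : Fin P.chans)
    (k : Fin (P.delay c)) : X.received c k = P.init c k := by
  -- Register `j` emits in instant `n ≤ j` what register `j - n` emitted in the first instant.
  have : ∀ (n : ℕ) (j : Fin (P.delay c)) (h : n ≤ j.val),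
      X.sig n ⟨c, j.succ⟩ = P.init c ⟨j.rev + n, by rw [Fin.val_rev]; omega⟩ := by
    intro n
    induction n with
    | zero => exact fun j _ => X.sig_succ hP 0 c j
    | succ n ih =>
      intro j hj
      have e : j.castSucc = (⟨j - 1, by omega⟩ : Fin (P.delay c)).succ :=
        Fin.ext (by simp only [Fin.val_castSucc, Fin.succ_mk]; omega)
      rw [X.sig_succ hP, CentralExec.regs, e, ih _ (by simp only; omega)]
      congr 1
      exact Fin.ext (by simp only [Fin.val_rev]; omega)
  obtain ⟨k, hk⟩ := k
  have e : Fin.last (P.delay c) = (⟨P.delay c - 1, by omega⟩ : Fin (P.delay c)).succ :=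
    Fin.ext (by simp only [Fin.val_last, Fin.succ_mk]; omega)
  rw [CentralExec.received, e, this _ _ (by simp only; omega)]
  congr 1
  exact Fin.ext (by simp only [Fin.val_rev]; omega)

/-! ### Steps of the distributed target -/

/-- The invariant of the distributed target, relative to the centralised execution: a thread with
clock `k` is in its state before instant `k`, and each FIFO holds precisely the tokens that the
receiver has yet to read and that have already been sent. -/
structure DistInv (X : P.CentralExec) (s : P.Config) : Prop where
  bind : ∀ i, (s.prog i).bind = fun _ p => p
  inst : ∀ i, (s.prog i).inst () = (X.state (s.clock i)).inst (.inl i)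
  fifo : ∀ c, ∃ n, s.clock (P.dst c) + n = s.clock (P.src c) + P.delay c ∧
    s.fifo c = (List.range' (s.clock (P.dst c)) n).map (X.received c)

lemma distInv_distributed (hP : P.WellFormed) (X : P.CentralExec) : DistInv X P.distributed where
  bind _ := rfl
  inst i := by rw [show P.distributed.clock i = 0 from rfl, X.start]; rfl
  fifo c := by
    refine ⟨P.delay c, rfl, List.ext_getElem (by simp [distributed]) fun k h₁ h₂ => ?_⟩
    have hk : k < P.delay c := by simpa [distributed] using h₁
    simpa [distributed] using (X.received_of_lt hP c ⟨k, hk⟩).symm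

lemma DistInv.head? {X : P.CentralExec} {s : P.Config} (hs : DistInv X s) {c : Fin P.chans}
    (hc : s.fifo c ≠ []) : (s.fifo c).head? = some (X.received c (s.clock (P.dst c))) := by
  obtain ⟨n, -, h⟩ := hs.fifo c
  rw [h] at hc ⊢
  cases n with
  | zero => simp at hc
  | succ n => simp [List.range'_succ]

/-- A thread that makes a tick at clock `k` reads and writes the tokens of instant `k`. -/
lemma DistInv.tokens (hP : P.WellFormed) {X : P.CentralExec} {s s' : P.Config} {F E}
    (hs : DistInv X s) (h : Config.Step F E s s') {i : Fin P.threads} (hi : i ∈ F) :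
    (∀ c, P.dst c = i → E i (.inp c) = X.received c (s.clock i)) ∧
    (∀ c, P.src c = i → E i (.out c) = X.sig (s.clock i) ⟨c, 0⟩) ∧
    (s'.prog i).bind = (fun _ p => p) ∧
    (s'.prog i).inst () = (X.state (s.clock i + 1)).inst (.inl i) := by
  have hin : ∀ c, P.dst c = i → E i (.inp c) = X.received c (s.clock i) := by
    intro c hc
    have := (h.pop i hi c hc).symm.trans (hs.head? (h.ready i hi c hc))
    rw [hc] at this
    exact Option.some_injective _ this
  obtain ⟨out, ht, hE, hb, -⟩ := h.react i hi
  obtain ⟨-, o, ho, ht'⟩ := X.threadStep hP (s.clock i) i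
  have e := (ht ()).symm.trans
    ((congrArg _ (hs.inst i)).trans (ht' _ fun c hc => by simp only [hs.bind]; exact hin c hc))
  simp only [Option.some.injEq, Prod.mk.injEq] at e
  refine ⟨hin, fun c hc => Option.ext fun v => ?_, hb.trans (hs.bind i), e.1⟩
  rw [hE (.out c) id v, hs.bind]
  constructor
  · rintro ⟨_, _, rfl, hv⟩
    rw [e.2] at hv
    obtain ⟨_, -, hcc, hv⟩ := (ho _ _).1 hv
    cases hcc
    exact hv
  · exact fun hv => ⟨(), _, rfl, e.2 ▸ (ho _ _).2 ⟨c, mem_outs.2 hc, rfl, hv⟩⟩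

lemma Config.Step.clock_eq {s s' : P.Config} {F E} (h : Config.Step F E s s')
    (i : Fin P.threads) : s'.clock i = s.clock i + if i ∈ F then 1 else 0 := by
  split_ifs with hi
  · exact h.tick i hi
  · exact (h.idle i hi).2

lemma DistInv.step (hP : P.WellFormed) {X : P.CentralExec} {s s' : P.Config} {F E}
    (hs : DistInv X s) (h : Config.Step F E s s') : DistInv X s' where
  bind i := by
    by_cases hi : i ∈ F
    · exact (hs.tokens hP h hi).2.2.1
    · rw [(h.idle i hi).1, hs.bind]
  inst i := by
    by_cases hi : i ∈ F
    · rw [h.tick i hi, (hs.tokens hP h hi).2.2.2]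
    · rw [(h.idle i hi).1, (h.idle i hi).2, hs.inst]
  fifo c := by
    -- The pop advances the left end of the range, the push its right end.
    have hpop : ∃ n, s'.clock (P.dst c) + n = s.clock (P.src c) + P.delay c ∧
        (if P.dst c ∈ F then (s.fifo c).tail else s.fifo c) =
          (List.range' (s'.clock (P.dst c)) n).map (X.received c) := by
      obtain ⟨n, hn, hf⟩ := hs.fifo c
      rw [h.clock_eq]
      split_ifs with hd
      · have hne := h.ready _ hd c rfl
        cases n with
        | zero => simp [hf] at hne
        | succ n => exact ⟨n, by omega, by simp [hf, List.range'_succ]⟩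
      · exact ⟨n, hn, hf⟩
    obtain ⟨n, hn, hf⟩ := hpop
    rw [h.fifo, hf, h.clock_eq (P.src c)]
    split_ifs with hi
    · refine ⟨n + 1, by omega, ?_⟩
      rw [(hs.tokens hP h hi).2.1 c rfl, ← X.received_add_delay hP, ← hn, List.range'_concat]
      simp
    · exact ⟨n, by omega, by simp⟩

/-- Any set of ready threads can make a tick. -/
lemma DistInv.exists_step (hP : P.WellFormed) {X : P.CentralExec} {s : P.Config}
    (hs : DistInv X s) {F : Finset (Fin P.threads)} (hF : ∀ i ∈ F, s.Ready i) :
    ∃ E s', Config.Step F E s s' := by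
  let E (i : Fin P.threads) : Port P.chans → Token H
    | .inp c => if P.dst c = i then X.received c (s.clock i) else none
    | .out c => if P.src c = i then X.sig (s.clock i) ⟨c, 0⟩ else none
  refine ⟨E,
    { prog := fun i => if i ∈ F then
        { bind := (s.prog i).bind
          inst := fun _ => (X.state (s.clock i + 1)).inst (.inl i)
          pre := E i } else s.prog i
      fifo := fun c => (if P.dst c ∈ F then (s.fifo c).tail else s.fifo c) ++
        (if P.src c ∈ F then [E (P.src c) (.out c)] else [])
      clock := fun i => if i ∈ F then s.clock i + 1 else s.clock i },
    hF, ?_, ?_, fun i hi => by simp [hi], fun i hi => by simp [hi], fun c => rfl⟩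
  · rintro i hi c rfl
    simpa [E] using hs.head? (hF _ hi c rfl)
  · intro i hi
    obtain ⟨-, o, ho, ht⟩ := X.threadStep hP (s.clock i) i
    simp only [hi, if_true]
    refine ⟨fun _ => o, fun _ => ?_, ?_, rfl, rfl⟩
    · rw [show (s.prog i).inst _ = _ from hs.inst i]
      refine ht _ fun c hc => ?_
      simp only [hs.bind, E, hc, if_true]
      rfl
    · intro p hp v
      rw [hs.bind]
      have hpo : (∃ (_ : Unit) (q : Port P.chans), q = p ∧ (q, v) ∈ o) ↔ (p, v) ∈ o := by simp
      rw [hpo, ho]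
      cases p with
      | inp c =>
        have hc : P.dst c ≠ i := hp
        simp [E, hc]
      | out c =>
        by_cases hc : P.src c = i
        · simp [E, hc, mem_outs]
        · simp [E, hc, mem_outs]

lemma DistExec.inv (hP : P.WellFormed) (D : P.DistExec) (X : P.CentralExec) (t : ℕ) :
    DistInv X (D.state t) := by
  induction t with
  | zero => exact D.start ▸ distInv_distributed hP X
  | succ t ih => exact ih.step hP (D.step t)

theorem DistExec.corresponds (hP : P.WellFormed) (D : P.DistExec) (X : P.CentralExec) :
    Corresponds D X where
  state t := (D.inv hP X t).inst
  input t _ hi := ((D.inv hP X t).tokens hP (D.step t) hi).1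
  output t _ hi := ((D.inv hP X t).tokens hP (D.step t) hi).2.1

/-! ### Fair executions -/

lemma DistExec.clock_mono (D : P.DistExec) (i : Fin P.threads) :
    Monotone fun t => (D.state t).clock i :=
  monotone_nat_of_le_succ fun t => by simp [(D.step t).clock_eq i]

/-- In a fair execution all clocks diverge. Once all threads have reached clock `k`, a thread at clock
`k` finds a token on each inbound channel of positive delay, and also on those of delay `0` after
their senders have reached clock `k + 1`. -/
lemma DistExec.Fair.exists_le_clock (hP : P.WellFormed) {D : P.DistExec} (hD : D.Fair)
    (X : P.CentralExec) (k : ℕ) (i : Fin P.threads) : ∃ t, k ≤ (D.state t).clock i := by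
  induction k generalizing i with
  | zero => exact ⟨0, Nat.zero_le _⟩
  | succ k ihk =>
    induction i using hP.wellFounded_zeroDelay.induction with
    | _ i ihi =>
      choose T hT using ihk
      choose U hU using ihi
      obtain ⟨B, hB⟩ := Finite.exists_le T
      obtain ⟨C, hC⟩ := Finite.exists_le fun j : {j // P.ZeroDelay j i} => U j j.2
      have hk : ∀ j, k ≤ (D.state (max B C)).clock j := fun j =>
        (hT j).trans (D.clock_mono j ((hB j).trans (le_max_left _ _)))
      have hk' : ∀ j, P.ZeroDelay j i → k + 1 ≤ (D.state (max B C)).clock j := fun j hj =>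
        (hU j hj).trans (D.clock_mono j ((hC ⟨j, hj⟩).trans (le_max_right _ _)))
      obtain hlt | hle := (hk i).lt_or_eq
      · exact ⟨_, hlt⟩
      · have hready : (D.state (max B C)).Ready i := by
          rintro c rfl hc
          obtain ⟨n, hn, hf⟩ := (D.inv hP X (max B C)).fifo c
          obtain rfl : n = 0 := by simpa [hc] using hf.symm
          have h₁ := hk (P.src c)
          have h₂ := fun h0 => hk' (P.src c) ⟨c, rfl, rfl, h0⟩
          omega
        obtain ⟨t, ht, hi⟩ := hD _ i hready
        refine ⟨t + 1, ?_⟩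
        rw [(D.step t).tick i hi]
        exact Nat.succ_le_succ (hle.le.trans (D.clock_mono i ht))

theorem DistExec.Fair.existsUnique_tick (hP : P.WellFormed) {D : P.DistExec} (hD : D.Fair)
    (X : P.CentralExec) (i : Fin P.threads) (k : ℕ) :
    ∃! t, i ∈ D.fires t ∧ (D.state t).clock i = k := by
  classical
  have hex := hD.exists_le_clock hP X (k + 1) i
  -- The tick at clock `k` is the step before the first state in which the clock exceeds `k`.
  obtain ⟨t, ht⟩ : ∃ t, Nat.find hex = t + 1 := by
    refine Nat.exists_eq_succ_of_ne_zero fun h0 => ?_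
    have := Nat.find_spec hex
    rw [h0, D.start] at this
    exact Nat.not_succ_le_zero k this
  have h₁ := Nat.find_spec hex
  have h₂ := Nat.find_min hex (m := t) (by omega)
  rw [ht] at h₁
  have h₃ := (D.step t).clock_eq i
  have hi : i ∈ D.fires t := by
    by_contra hi
    simp only [hi, if_false] at h₃
    omega
  simp only [hi, if_true] at h₃
  have hk : (D.state t).clock i = k := by omega
  have later : ∀ {u v}, i ∈ D.fires u → (D.state u).clock i = k → u < v →
      (D.state v).clock i ≠ k := by
    intro u v hu hk huv
    have h : (D.state (u + 1)).clock i ≤ (D.state v).clock i := D.clock_mono i huv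
    rw [(D.step u).tick i hu] at h
    omega
  refine ⟨t, ⟨hi, hk⟩, fun u hu => ?_⟩
  rcases lt_trichotomy u t with h | h | h
  · exact absurd hk (later hu.1 hu.2 h)
  · exact h
  · exact absurd hu.2 (later hi hk h)

/-- The eager continuation, in which all ready threads make a tick in every step. -/
lemma DistInv.exists_eager (hP : P.WellFormed) {X : P.CentralExec} {s : P.Config}
    (hs : DistInv X s) : ∃ (st : ℕ → P.Config) (F : ℕ → Finset (Fin P.threads))
      (E : ℕ → Fin P.threads → Port P.chans → Token H), st 0 = s ∧
      (∀ t, Config.Step (F t) (E t) (st t) (st (t + 1))) ∧ ∀ t i, (st t).Ready i → i ∈ F t := by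
  classical
  let F (s : P.Config) : Finset (Fin P.threads) := Finset.univ.filter s.Ready
  choose E next h using fun s : {s : P.Config // DistInv X s} =>
    s.2.exists_step hP (F := F s) fun i hi => (Finset.mem_filter.1 hi).2
  let st (t : ℕ) : {s : P.Config // DistInv X s} :=
    (fun s => ⟨next s, s.2.step hP (h s)⟩)^[t] ⟨s, hs⟩
  refine ⟨fun t => st t, fun t => F (st t), fun t => E (st t), rfl, fun t => ?_,
    fun t i hi => Finset.mem_filter.2 ⟨Finset.mem_univ _, hi⟩⟩
  simp only [st, Function.iterate_succ_apply']
  exact h _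

lemma Config.Step.ready_of_notMem {s s' : P.Config} {F E} (h : Config.Step F E s s') {i : Fin P.threads}
    (hi : i ∉ F) (hr : s.Ready i) : s'.Ready i := by
  rintro c rfl
  simp [h.fifo, hi, hr c rfl]

/-- An execution is fair if from some step on all ready threads make a tick. -/
lemma DistExec.fair_of_eager {D : P.DistExec} (T : ℕ)
    (h : ∀ t ≥ T, ∀ i, (D.state t).Ready i → i ∈ D.fires t) : D.Fair := by
  intro t i hr
  by_contra! hn
  have : ∀ n, (D.state (t + n)).Ready i := by
    intro n
    induction n with
    | zero => exact hr
    | succ n ih => exact (D.step (t + n)).ready_of_notMem (hn _ (by omega)) ih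
  exact hn (t + T) (by omega) (h _ (by omega) i (this T))

theorem exists_fair (hP : P.WellFormed) (X : P.CentralExec) : ∃ D : P.DistExec, D.Fair := by
  obtain ⟨st, F, E, h0, hst, hF⟩ := (distInv_distributed hP X).exists_eager hP
  exact ⟨⟨st, F, E, h0, hst⟩, DistExec.fair_of_eager 0 fun t _ => hF t⟩

theorem DistExec.exists_fair_extension (hP : P.WellFormed) (X : P.CentralExec) (D : P.DistExec)
    (T : ℕ) : ∃ D' : P.DistExec, D'.Fair ∧ D.AgreeUpTo T D' := by
  obtain ⟨st, F, E, h0, hst, hF⟩ := (D.inv hP X T).exists_eager hP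
  let D' : P.DistExec :=
    { state := fun t => if t ≤ T then D.state t else st (t - T)
      fires := fun t => if t < T then D.fires t else F (t - T)
      sig := fun t => if t < T then D.sig t else E (t - T)
      start := by simp [D.start]
      step := fun t => by
        rcases lt_or_ge t T with h | h
        · simpa [h, h.le, Nat.succ_le_iff] using D.step t
        · have e : (if t ≤ T then D.state t else st (t - T)) = st (t - T) := by
            split_ifs with h'
            · obtain rfl := le_antisymm h' h
              simp [h0]
            · rfl
          have := hst (t - T)
          rw [← Nat.sub_add_comm h] at this
          simpa [e, h.not_gt, show ¬ t + 1 ≤ T by omega] using this }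
  refine ⟨D', fair_of_eager (T + 1) fun t ht i hr => ?_, fun t ht => ?_, fun t ht => ?_⟩
  · have h₁ : ¬ t ≤ T := by omega
    have h₂ : ¬ t < T := by omega
    simp only [D', h₁, h₂, if_false] at hr ⊢
    exact hF _ _ hr
  · simp [D', ht]
  · simp [D', ht]

end Program

end Timetide

theorem mainTheorem2 {H : Type*} (P : Timetide.Program H) (hP : P.WellFormed) :
    ∃ X : P.CentralExec,
      (∀ Y : P.CentralExec, Y = X) ∧
      (∀ D : P.DistExec, Timetide.Program.Corresponds D X) ∧
      (∀ D : P.DistExec, D.Fair →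
        ∀ (i : Fin P.threads) (k : ℕ), ∃! t, i ∈ D.fires t ∧ (D.state t).clock i = k) ∧
      (∃ D : P.DistExec, D.Fair) ∧
      (∀ (D : P.DistExec) (T : ℕ), ∃ D' : P.DistExec, D'.Fair ∧ D.AgreeUpTo T D') := by
  obtain ⟨X⟩ := Timetide.Program.exists_centralExec hP
  exact ⟨X, Timetide.Program.CentralExec.unique hP X, fun D => D.corresponds hP X,
    fun D hD => hD.existsUnique_tick hP X, Timetide.Program.exists_fair hP X,
    fun D => D.exists_fair_extension hP X⟩
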